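/- Let $\beta:[0,\infty)\to[-1,1]$ be a Borel function. For $0\le s<t$ and $x,y\in\mathbb{R}$ set $$ p^{\beta}(s,t;x,y):=\int_0^{t-s}\frac{1+\mathrm{sgn}(y)\,\beta(s+u)}{2}\,\frac{|y|}{\pi}\,\frac{e^{-\frac{y^2}{2(t-s-u)}}}{\sqrt{u}\,(t-s-u)^{3/2}}\,e^{-\frac{x^2}{2u}}\,du+\frac{1}{\sqrt{2\pi(t-s)}}\left[e^{-\frac{(y-x)^2}{2(t-s)}}-e^{-\frac{(y+x)^2}{2(t-s)}}\right]\mathbf{1}_{xy>0}, $$ where $\mathrm{sgn}(0)=0$. Then, for all $0\le s<t$, the integral converges for all $x,y\in\mathbb{R}$, and $p^\beta(s,t;\cdot,\cdot)$ is a nonnegative Borel function on $\mathbb{R}^2$. The measures $P_{s,t}(x,dy)=p^\beta(s,t;x,y)\,dy$ form an inhomogeneous family of transition probabilities on $\mathbb{R}$: for all $0\le s<t$ and $x\in\mathbb{R}$, $P_{s,t}(x,\cdot)$ is a probability measure; for every Borel set $A\subseteq\mathbb{R}$ the map $x\mapsto P_{s,t}(x,A)$ is Borel measurable; and $\int_{\mathbb{R}}P_{s,t}(x,dy)\,P_{t,v}(y,A)=P_{s,v}(x,A)$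 whenever $0\le s<t<v$. Moreover, the Chapman--Kolmogorov equation holds pointwise for the densities: for all $0\le s<t<v$ and all $x,z\in\mathbb{R}$, the function $y\mapsto p^\beta(s,t;x,y)\,p^\beta(t,v;y,z)$ is integrable on $\mathbb{R}$ and $$ \int_{-\infty}^{\infty}p^\beta(s,t;x,y)\,p^\beta(t,v;y,z)\,dy=p^\beta(s,v;x,z). $$ -/

import Mathlib

open MeasureTheory Set
open scoped NNReal ENNReal

namespace SkewBM

/-- The shift operator on time-dependent functions: `(β ∘ σ_t)(s) = β (t + s)`. -/
def shift (t : ℝ≥0) (β : ℝ≥0 → ℝ) : ℝ≥0 → ℝ := fun s => β (t + s)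

/-- The integrand (in `u ∈ (0, t - s)`) of the first term of the density. The sign function is the
symmetric one, `sgn 0 = 0`. Only values at `u ≥ 0` matter, where `u.toNNReal` is `u`. -/
noncomputable def crossingIntegrand (β : ℝ≥0 → ℝ) (s t : ℝ≥0) (x y u : ℝ) : ℝ :=
  (1 + Real.sign y * shift s β u.toNNReal) / 2 * (|y| / Real.pi)
    * (Real.exp (-(y ^ 2 / (2 * ((t : ℝ) - (s + u)))))
        / (Real.sqrt u * ((t : ℝ) - s - u) ^ ((3 : ℝ) / 2)))
    * Real.exp (-(x ^ 2 / (2 * u)))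

/-- The second term of the density: the transition density of Brownian motion killed at `0`. -/
noncomputable def killedDensity (s t : ℝ≥0) (x y : ℝ) : ℝ :=
  if 0 < x * y then
    1 / Real.sqrt (2 * Real.pi * ((t : ℝ) - s))
      * (Real.exp (-((y - x) ^ 2 / (2 * ((t : ℝ) - s))))
          - Real.exp (-((y + x) ^ 2 / (2 * ((t : ℝ) - s)))))
  else 0

/-- The function `p^β(s,t;x,y)`, meant for `s < t`. -/
noncomputable def density (β : ℝ≥0 → ℝ) (s t : ℝ≥0) (x y : ℝ) : ℝ :=
  (∫ u in (0 : ℝ)..((t : ℝ) - s), crossingIntegrand β s t x y u) + killedDensity s t x y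

/-- The measure `p^β(s,t;x,y) dy` on `ℝ`. -/
noncomputable def transitionMeasure (β : ℝ≥0 → ℝ) (s t : ℝ≥0) (x : ℝ) : Measure ℝ :=
  volume.withDensity (fun y => ENNReal.ofReal (density β s t x y))

/-- An inhomogeneous family of transition probabilities on `E` (a transition function), indexed by
times `0 ≤ s < t`: each `P s t` is a probability kernel, and for `s < t < v` the kernels compose,
`∫ P s t x (dy) P t v y A = P s v x A`. -/
structure IsTransitionFunction {E : Type*} [MeasurableSpace E]
    (P : ℝ≥0 → ℝ≥0 → E → Measure E) : Prop where
  isProbabilityMeasure : ∀ s t : ℝ≥0, s < t → ∀ x : E, IsProbabilityMeasure (P s t x)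
  measurable : ∀ s t : ℝ≥0, s < t → ∀ A : Set E, MeasurableSet A →
    Measurable (fun x => P s t x A)
  comp : ∀ s t v : ℝ≥0, s < t → t < v → ∀ (x : E) (A : Set E), MeasurableSet A →
    ∫⁻ y, P t v y A ∂(P s t x) = P s v x A

end SkewBM

/-! Write `g_τ` for the heat kernel, `h_τ(y) = |y|/τ * g_τ(y)`, and `k_τ` for the kernel of Brownian
motion killed at `0`. With `T = t - s`, the density is `k_T(x,y)` plus the integral over `u ∈ (0,T)`
of `(1 + sgn(y) β(s+u)) g_u(x) h_{T-u}(y)`. Heuristically, `u` is the time since `s` of the last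
zero: `k` accounts for paths without a zero, and `β(s+u)` biases the sign of the final excursion.

Total mass comes from symmetrising in `y`. In the sum over `y` and `-y` the `β` terms cancel, and
the first-passage identity `∫ g_u(x) h_{T-u}(y) du = g_T(|x|+|y|)` turns the rest into `g_T(y-x) +
g_T(y+x)` (`density_add_density_neg`). Hence even functions have the same integrals against the skew
density as against the heat kernel.

For Chapman–Kolmogorov at an intermediate time `t`, split by the position of the last zero. If it
lies after `t`, the second factor depends on the intermediate point `y` only through the even
function `g_w(y)`, so the heat semigroup applies (`lintegral_density_mul_crossing`). If it lies
before `t`, the path keeps its sign afterwards, and `h` is an entrance law for `k`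
(`lintegral_crossing_mul_killedKernel`). If there is no zero, the semigroup property of `k` applies.
All terms are nonnegative, so Tonelli suffices; integrability follows from finiteness of the result.
-/

namespace SkewBM

/-! ### Gaussian integrals and the heat semigroup -/

/-- The centred Gaussian density of variance `τ`. -/
noncomputable def gaussKernel (τ x : ℝ) : ℝ :=
  Real.exp (-(x ^ 2 / (2 * τ))) / Real.sqrt (2 * Real.pi * τ)

/-- The density in `τ` of the hitting time of `0` by a Brownian motion started at `y`. -/
noncomputable def hitKernel (τ y : ℝ) : ℝ := |y| / τ * gaussKernel τ y

lemma gaussKernel_nonneg (τ x : ℝ) : 0 ≤ gaussKernel τ x := by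
  unfold gaussKernel; positivity

lemma hitKernel_nonneg {τ : ℝ} (hτ : 0 ≤ τ) (y : ℝ) : 0 ≤ hitKernel τ y :=
  mul_nonneg (div_nonneg (abs_nonneg y) hτ) (gaussKernel_nonneg τ y)

@[simp] lemma gaussKernel_neg (τ x : ℝ) : gaussKernel τ (-x) = gaussKernel τ x := by
  simp [gaussKernel]

lemma gaussKernel_sub_comm (τ x y : ℝ) : gaussKernel τ (x - y) = gaussKernel τ (y - x) := by
  rw [← gaussKernel_neg, neg_sub]

@[simp] lemma hitKernel_neg (τ x : ℝ) : hitKernel τ (-x) = hitKernel τ x := by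
  simp [hitKernel]

lemma gaussKernel_sub_eq {τ : ℝ} (hτ : 0 < τ) (m y : ℝ) :
    gaussKernel τ (y - m) = ProbabilityTheory.gaussianPDFReal m τ.toNNReal y := by
  rw [gaussKernel, ProbabilityTheory.gaussianPDFReal, Real.coe_toNNReal _ hτ.le, neg_div,
    div_eq_inv_mul _ (Real.sqrt _)]

lemma integrable_gaussKernel_sub {τ : ℝ} (hτ : 0 < τ) (m : ℝ) :
    Integrable (fun y => gaussKernel τ (y - m)) := by
  simp_rw [gaussKernel_sub_eq hτ]
  exact ProbabilityTheory.integrable_gaussianPDFReal _ _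

lemma integral_gaussKernel_sub {τ : ℝ} (hτ : 0 < τ) (m : ℝ) :
    ∫ y, gaussKernel τ (y - m) = 1 := by
  simp_rw [gaussKernel_sub_eq hτ]
  exact ProbabilityTheory.integral_gaussianPDFReal_eq_one _
    (Real.toNNReal_pos.2 hτ).ne'

lemma integrable_mul_gaussKernel_sub {τ : ℝ} (hτ : 0 < τ) (m : ℝ) :
    Integrable (fun y => y * gaussKernel τ (y - m)) := by
  have h0 : Integrable (fun y => y * gaussKernel τ y) := by
    have h := (integrable_mul_exp_neg_mul_sq (b := 1 / (2 * τ)) (by positivity)).div_const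
      (Real.sqrt (2 * Real.pi * τ))
    refine h.congr (Filter.Eventually.of_forall fun y => ?_)
    simp only [gaussKernel, mul_div_assoc]
    congr 4
    ring
  have h1 := (h0.comp_sub_right m).add ((integrable_gaussKernel_sub hτ m).const_mul m)
  refine h1.congr (Filter.Eventually.of_forall fun y => ?_)
  simp only [Pi.add_apply]
  ring

lemma integral_mul_gaussKernel_sub {τ : ℝ} (hτ : 0 < τ) (m : ℝ) :
    ∫ y, y * gaussKernel τ (y - m) = m := by
  have h0 : ∫ y, y * gaussKernel τ y = 0 := by
    have h : ∫ y, (-y) * gaussKernel τ (-y) = ∫ y, y * gaussKernel τ y :=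
      integral_neg_eq_self (fun y => y * gaussKernel τ y) volume
    simp only [gaussKernel_neg, neg_mul, integral_neg] at h
    linarith
  have h1 : ∫ y, (y - m) * gaussKernel τ (y - m) = 0 := by
    rw [integral_sub_right_eq_self (fun y => y * gaussKernel τ y), h0]
  have h2 : ∫ y, (y - m) * gaussKernel τ (y - m)
      = (∫ y, y * gaussKernel τ (y - m)) - ∫ y, m * gaussKernel τ (y - m) := by
    rw [← integral_sub (integrable_mul_gaussKernel_sub hτ m)
      ((integrable_gaussKernel_sub hτ m).const_mul m)]
    simp only [sub_mul]
  rw [integral_const_mul, integral_gaussKernel_sub hτ] at h2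
  linarith

/-- Completing the square in `y` produces a Gaussian with the mean and variance of a Brownian
bridge. Integrals of the product then reduce to the mass and mean of one Gaussian. -/
lemma gaussKernel_mul_gaussKernel_sub {τ σ : ℝ} (hτ : 0 < τ) (hσ : 0 < σ) (y z : ℝ) :
    gaussKernel τ y * gaussKernel σ (y - z)
      = gaussKernel (τ + σ) z * gaussKernel (τ * σ / (τ + σ)) (y - z * τ / (τ + σ)) := by
  unfold gaussKernel
  have hpi := Real.pi_pos
  have : 0 < τ + σ := by positivity
  rw [div_mul_div_comm, div_mul_div_comm, ← Real.exp_add, ← Real.exp_add,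
    ← Real.sqrt_mul (by positivity), ← Real.sqrt_mul (by positivity)]
  congr 2
  · field_simp
    ring
  · field_simp

lemma integrable_gaussKernel_mul {τ σ : ℝ} (hτ : 0 < τ) (hσ : 0 < σ) (x z : ℝ) :
    Integrable (fun y => gaussKernel τ (y - x) * gaussKernel σ (y - z)) := by
  have h : Integrable (fun y => gaussKernel τ y * gaussKernel σ (y - (z - x))) := by
    simp_rw [gaussKernel_mul_gaussKernel_sub hτ hσ]
    exact (integrable_gaussKernel_sub (by positivity) _).const_mul _
  refine (h.comp_sub_right x).congr (Filter.Eventually.of_forall fun y => ?_)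
  simp

/-- The semigroup property of the heat kernel. -/
lemma integral_gaussKernel_mul {τ σ : ℝ} (hτ : 0 < τ) (hσ : 0 < σ) (x z : ℝ) :
    ∫ y, gaussKernel τ (y - x) * gaussKernel σ (y - z) = gaussKernel (τ + σ) (z - x) := by
  have h : ∫ y, gaussKernel τ y * gaussKernel σ (y - (z - x)) = gaussKernel (τ + σ) (z - x) := by
    simp_rw [gaussKernel_mul_gaussKernel_sub hτ hσ]
    rw [integral_const_mul, integral_gaussKernel_sub (by positivity), mul_one]
  have h' := integral_sub_right_eq_self (μ := volume)
    (fun y => gaussKernel τ y * gaussKernel σ (y - (z - x))) x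
  simpa [h] using h'

lemma integrable_deriv_gaussKernel_mul {τ σ : ℝ} (hτ : 0 < τ) (hσ : 0 < σ) (z : ℝ) :
    Integrable (fun y => y / τ * gaussKernel τ y * gaussKernel σ (y - z)) := by
  have h : ∀ y, y / τ * gaussKernel τ y * gaussKernel σ (y - z) = gaussKernel (τ + σ) z / τ *
      (y * gaussKernel (τ * σ / (τ + σ)) (y - z * τ / (τ + σ))) := by
    intro y
    rw [mul_assoc, gaussKernel_mul_gaussKernel_sub hτ hσ]
    ring
  simp_rw [h]
  exact (integrable_mul_gaussKernel_sub (by positivity) _).const_mul _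

/-- Since `y / τ * gaussKernel τ y` is minus the space derivative of the heat kernel, this is the
semigroup property differentiated; it is obtained from the bridge mean `z τ / (τ + σ)`. -/
lemma integral_deriv_gaussKernel_mul {τ σ : ℝ} (hτ : 0 < τ) (hσ : 0 < σ) (z : ℝ) :
    ∫ y, y / τ * gaussKernel τ y * gaussKernel σ (y - z)
      = z / (τ + σ) * gaussKernel (τ + σ) z := by
  have h : ∀ y, y / τ * gaussKernel τ y * gaussKernel σ (y - z) = gaussKernel (τ + σ) z / τ *
      (y * gaussKernel (τ * σ / (τ + σ)) (y - z * τ / (τ + σ))) := by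
    intro y
    rw [mul_assoc, gaussKernel_mul_gaussKernel_sub hτ hσ]
    ring
  simp_rw [h]
  rw [integral_const_mul, integral_mul_gaussKernel_sub (by positivity)]
  field_simp

/-! ### Killed Brownian motion by the method of images -/

lemma integral_Ioi_odd_mul {a b : ℝ → ℝ} (ha : ∀ y, a (-y) = -a y)
    (hab : Integrable (fun y => a y * b y)) :
    IntegrableOn (fun y => a y * (b y - b (-y))) (Ioi 0) ∧
      ∫ y in Ioi (0 : ℝ), a y * (b y - b (-y)) = ∫ y, a y * b y := by
  have hneg : Integrable (fun y => a (-y) * b (-y)) := hab.comp_neg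
  have hsum : ∀ y, a y * (b y - b (-y)) = a y * b y + a (-y) * b (-y) := by
    intro y
    rw [ha]
    ring
  simp_rw [hsum]
  refine ⟨(hab.add hneg).integrableOn, ?_⟩
  rw [integral_add hab.integrableOn hneg.integrableOn,
    integral_comp_neg_Ioi (0 : ℝ) (fun y => a y * b y), neg_zero, add_comm]
  have h := integral_add_compl (measurableSet_Iic (a := (0 : ℝ))) hab
  rwa [compl_Iic] at h

/-- The transition density over a time span `τ` of Brownian motion killed at `0`. -/
noncomputable def killedKernel (τ x y : ℝ) : ℝ :=
  if 0 < x * y then gaussKernel τ (y - x) - gaussKernel τ (y + x) else 0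

lemma killedDensity_eq (s t : ℝ≥0) (x y : ℝ) :
    killedDensity s t x y = killedKernel ((t : ℝ) - s) x y := by
  unfold killedDensity killedKernel gaussKernel
  split_ifs
  · ring
  · rfl

lemma killedKernel_neg_neg (τ x y : ℝ) : killedKernel τ (-x) (-y) = killedKernel τ x y := by
  unfold killedKernel
  rw [neg_mul_neg, ← gaussKernel_neg τ (-y - -x), ← gaussKernel_neg τ (-y + -x)]
  congr 3 <;> ring

lemma killedKernel_nonneg {τ : ℝ} (hτ : 0 < τ) (x y : ℝ) : 0 ≤ killedKernel τ x y := by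
  unfold killedKernel gaussKernel
  split_ifs with h
  · rw [sub_nonneg]
    have h' : (y - x) ^ 2 ≤ (y + x) ^ 2 := by nlinarith
    exact div_le_div_of_nonneg_right (Real.exp_le_exp.2 (neg_le_neg
      (div_le_div_of_nonneg_right h' (by positivity)))) (by positivity)
  · exact le_rfl

lemma measurable_killedKernel (τ : ℝ) : Measurable (fun q : ℝ × ℝ => killedKernel τ q.1 q.2) := by
  unfold killedKernel gaussKernel
  refine Measurable.ite (measurableSet_lt measurable_const (by fun_prop)) ?_ ?_ <;> fun_prop

/-- Method of images: for `z > 0` the killed kernel lives on `y > 0` and is a difference of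
reflected heat kernels. Replacing `f` by the odd function `a` that agrees with it there unfolds the
half-line integral to the whole line. -/
lemma integral_mul_killedKernel_of_pos {τ z : ℝ} {a f : ℝ → ℝ} (hz : 0 < z)
    (ha : ∀ y, a (-y) = -a y) (hf : ∀ y, 0 < y → f y = a y)
    (hi : Integrable (fun y => a y * gaussKernel τ (y - z))) :
    Integrable (fun y => f y * killedKernel τ y z) ∧
      ∫ y, f y * killedKernel τ y z = ∫ y, a y * gaussKernel τ (y - z) := by
  obtain ⟨h1, h2⟩ := integral_Ioi_odd_mul ha hi
  have h : (fun y => f y * killedKernel τ y z) = (Ioi (0 : ℝ)).indicator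
      (fun y => a y * (gaussKernel τ (y - z) - gaussKernel τ (-y - z))) := by
    ext y
    by_cases hy : 0 < y
    · rw [indicator_of_mem (by exact hy), killedKernel, if_pos (mul_pos hy hz), hf y hy,
        gaussKernel_sub_comm τ y z, ← gaussKernel_neg τ (-y - z)]
      congr 3
      ring
    · rw [indicator_of_notMem (by exact hy), killedKernel,
        if_neg (not_lt.2 (mul_nonpos_of_nonpos_of_nonneg (not_lt.1 hy) hz.le)), mul_zero]
  rw [h, integral_indicator measurableSet_Ioi, integrable_indicator_iff measurableSet_Ioi]
  exact ⟨h1, h2⟩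

/-- The hitting densities form an entrance law for the killed semigroup. -/
lemma integral_hitKernel_mul_killedKernel {τ σ : ℝ} (hτ : 0 < τ) (hσ : 0 < σ) (z : ℝ) :
    Integrable (fun y => hitKernel τ y * killedKernel σ y z) ∧
      ∫ y, hitKernel τ y * killedKernel σ y z = hitKernel (τ + σ) z := by
  have key : ∀ z : ℝ, 0 < z → Integrable (fun y => hitKernel τ y * killedKernel σ y z) ∧
      ∫ y, hitKernel τ y * killedKernel σ y z = hitKernel (τ + σ) z := by
    intro z hz
    rw [hitKernel, abs_of_pos hz, ← integral_deriv_gaussKernel_mul hτ hσ]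
    refine integral_mul_killedKernel_of_pos (a := fun y => y / τ * gaussKernel τ y) hz ?_ ?_
      (integrable_deriv_gaussKernel_mul hτ hσ z)
    · intro y
      simp only [gaussKernel_neg]
      ring
    · intro y hy
      simp only [hitKernel, abs_of_pos hy]
  rcases lt_trichotomy z 0 with hz | rfl | hz
  · obtain ⟨h1, h2⟩ := key (-z) (neg_pos.2 hz)
    have h : ∀ y, hitKernel τ (-y) * killedKernel σ (-y) (-z)
        = hitKernel τ y * killedKernel σ y z := by
      intro y
      rw [hitKernel_neg, killedKernel_neg_neg]
    constructor
    · simpa only [h] using h1.comp_neg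
    · rw [← hitKernel_neg, ← h2,
        ← integral_neg_eq_self (fun y => hitKernel τ y * killedKernel σ y (-z))]
      simp only [h]
  · simp [killedKernel, hitKernel]
  · exact key z hz

/-- The semigroup property of the killed kernel. -/
lemma integral_killedKernel_mul_killedKernel {τ σ : ℝ} (hτ : 0 < τ) (hσ : 0 < σ) (x z : ℝ) :
    Integrable (fun y => killedKernel τ x y * killedKernel σ y z) ∧
      ∫ y, killedKernel τ x y * killedKernel σ y z = killedKernel (τ + σ) x z := by
  have key : ∀ x z : ℝ, 0 < z → Integrable (fun y => killedKernel τ x y * killedKernel σ y z) ∧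
      ∫ y, killedKernel τ x y * killedKernel σ y z = killedKernel (τ + σ) x z := by
    intro x z hz
    by_cases hx : 0 < x
    · have h1 := integrable_gaussKernel_mul hτ hσ x z
      have h2 := integrable_gaussKernel_mul hτ hσ (-x) z
      have e : ∫ y, (gaussKernel τ (y - x) - gaussKernel τ (y - -x)) * gaussKernel σ (y - z)
          = killedKernel (τ + σ) x z := by
        simp_rw [sub_mul]
        rw [integral_sub h1 h2, integral_gaussKernel_mul hτ hσ, integral_gaussKernel_mul hτ hσ,
          killedKernel, if_pos (mul_pos hx hz), sub_neg_eq_add]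
      rw [← e]
      refine integral_mul_killedKernel_of_pos
        (a := fun y => gaussKernel τ (y - x) - gaussKernel τ (y - -x)) hz ?_ ?_ ?_
      · intro y
        rw [← gaussKernel_neg τ (-y - x), ← gaussKernel_neg τ (-y - -x), neg_sub]
        ring_nf
      · intro y hy
        rw [killedKernel, if_pos (mul_pos hx hy), sub_neg_eq_add]
      · simp_rw [sub_mul]
        exact h1.sub h2
    -- A nonzero product would force `y` to share its sign with both `z > 0` and `x`, but here `x ≤
    -- 0`.
    · have h : ∀ y, killedKernel τ x y * killedKernel σ y z = 0 := by
        intro y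
        unfold killedKernel
        split_ifs with h1 h2
        · exfalso
          have := pos_of_mul_pos_left h2 hz.le
          exact hx (pos_of_mul_pos_left h1 this.le)
        all_goals simp
      simp_rw [h]
      rw [killedKernel, if_neg]
      · simp
      · exact fun h' => hx (pos_of_mul_pos_left h' hz.le)
  rcases lt_trichotomy z 0 with hz | rfl | hz
  · obtain ⟨h1, h2⟩ := key (-x) (-z) (neg_pos.2 hz)
    have h : ∀ y, killedKernel τ (-x) (-y) * killedKernel σ (-y) (-z)
        = killedKernel τ x y * killedKernel σ y z := by
      intro y
      rw [killedKernel_neg_neg, killedKernel_neg_neg]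
    constructor
    · simpa only [h] using h1.comp_neg
    · rw [← killedKernel_neg_neg, ← h2,
        ← integral_neg_eq_self (fun y => killedKernel τ (-x) y * killedKernel σ y (-z))]
      simp only [h]
  · simp [killedKernel]
  · exact key x z hz
-- First-passage decomposition by an explicit antiderivative
open Filter Topology

lemma hasDerivAt_integral_exp_neg_sq_half (w : ℝ) :
    HasDerivAt (fun w => ∫ m in (0 : ℝ)..w, Real.exp (-(m ^ 2 / 2))) (Real.exp (-(w ^ 2 / 2))) w := by
  have hc : Continuous fun m : ℝ => Real.exp (-(m ^ 2 / 2)) := by fun_prop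
  exact intervalIntegral.integral_hasDerivAt_right (hc.intervalIntegrable _ _)
    (hc.stronglyMeasurableAtFilter _ _) hc.continuousAt

lemma tendsto_integral_exp_neg_sq_half_atTop :
    Tendsto (fun w => ∫ m in (0 : ℝ)..w, Real.exp (-(m ^ 2 / 2))) atTop
      (𝓝 (Real.sqrt (2 * Real.pi) / 2)) := by
  have e : (fun m : ℝ => Real.exp (-(m ^ 2 / 2))) = fun m => Real.exp (-(1 / 2) * m ^ 2) := by
    ext m
    congr 1
    ring
  rw [e]
  have h := intervalIntegral_tendsto_integral_Ioi (0 : ℝ)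
    (integrable_exp_neg_mul_sq (b := 1 / 2) (by norm_num)).integrableOn tendsto_id
  rw [integral_gaussian_Ioi] at h
  rwa [div_div_eq_mul_div, div_one, mul_comm Real.pi] at h

lemma tendsto_integral_exp_neg_sq_half_atBot :
    Tendsto (fun w => ∫ m in (0 : ℝ)..w, Real.exp (-(m ^ 2 / 2))) atBot
      (𝓝 (-(Real.sqrt (2 * Real.pi) / 2))) := by
  have h := (tendsto_integral_exp_neg_sq_half_atTop.comp tendsto_neg_atBot_atTop).neg
  refine h.congr fun w => ?_
  have := intervalIntegral.integral_comp_neg (a := 0) (b := w)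
    (fun m : ℝ => Real.exp (-(m ^ 2 / 2)))
  simp only [neg_sq, neg_zero] at this
  rw [Function.comp_apply, intervalIntegral.integral_symm, neg_neg, this]

/-- An antiderivative, up to a constant factor, of `u ↦ g_u(a) h_{T-u}(b)`. -/
noncomputable def hitPrimitive (T a b u : ℝ) : ℝ :=
  Real.exp (-(a * b / T)) * (∫ m in (0 : ℝ)..
      (b * (√u / √(T - u)) - a * (√(T - u) / √u)) / √T, Real.exp (-(m ^ 2 / 2)))
    + Real.exp (a * b / T) * (∫ m in (0 : ℝ)..
      (b * (√u / √(T - u)) + a * (√(T - u) / √u)) / √T, Real.exp (-(m ^ 2 / 2)))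

/-- The prefactors `exp (∓ab/T)` absorb the cross terms of the squared integration limits, so both
halves carry the same exponential. Adding them cancels the derivatives of the `a` terms and doubles
that of the `b` term. -/
lemma hasDerivAt_hitPrimitive {T a b u : ℝ} (hu : 0 < u) (huT : u < T) :
    HasDerivAt (hitPrimitive T a b)
      (b * √T * Real.exp (-((b ^ 2 * (u / (T - u)) + a ^ 2 * ((T - u) / u)) / (2 * T)))
        / (√u * (T - u) * √(T - u))) u := by
  have hT : 0 < T := hu.trans huT
  have hv : 0 < T - u := sub_pos.2 huT
  have d1 : HasDerivAt (fun u => √u) (1 / (2 * √u)) u := Real.hasDerivAt_sqrt hu.ne'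
  have d2 : HasDerivAt (fun u => √(T - u)) (-1 / (2 * √(T - u))) u :=
    ((hasDerivAt_id u).const_sub T).sqrt hv.ne'
  have p1 : 0 < √u := Real.sqrt_pos.2 hu
  have p2 : 0 < √(T - u) := Real.sqrt_pos.2 hv
  have p3 : 0 < √T := Real.sqrt_pos.2 hT
  have s1 : √u ^ 2 = u := Real.sq_sqrt hu.le
  have s2 : √(T - u) ^ 2 = T - u := Real.sq_sqrt hv.le
  have s3 : √T ^ 2 = T := Real.sq_sqrt hT.le
  have r1 : HasDerivAt (fun u => √u / √(T - u)) (T / (2 * √u * (T - u) * √(T - u))) u := by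
    refine (d1.div d2 p2.ne').congr_deriv ?_
    rw [s2]
    field_simp
    rw [s1, s2]
    ring
  have r2 : HasDerivAt (fun u => √(T - u) / √u) (-(T / (2 * u * √u * √(T - u)))) u := by
    refine (d2.div d1 p1.ne').congr_deriv ?_
    rw [s1]
    field_simp
    rw [s1, s2]
    ring
  have A := (hasDerivAt_integral_exp_neg_sq_half _).comp u
    (((r1.const_mul b).sub (r2.const_mul a)).div_const (√T))
  have B := (hasDerivAt_integral_exp_neg_sq_half _).comp u
    (((r1.const_mul b).add (r2.const_mul a)).div_const (√T))
  refine ((A.const_mul (Real.exp (-(a * b / T)))).add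
    (B.const_mul (Real.exp (a * b / T)))).congr_deriv ?_
  have q1 : (√u / √(T - u)) ^ 2 = u / (T - u) := by rw [div_pow, s1, s2]
  have q2 : (√(T - u) / √u) ^ 2 = (T - u) / u := by rw [div_pow, s1, s2]
  have q3 : (√u / √(T - u)) * (√(T - u) / √u) = 1 := by field_simp
  simp only [Pi.add_apply, Pi.sub_apply]
  have e1 : Real.exp (-(a * b / T)) * Real.exp (-(((b * (√u / √(T - u)) -
      a * (√(T - u) / √u)) / √T) ^ 2 / 2))
      = Real.exp (-((b ^ 2 * (u / (T - u)) + a ^ 2 * ((T - u) / u)) / (2 * T))) := by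
    rw [← Real.exp_add, div_pow, s3]
    congr 1
    rw [← q1, ← q2]
    field_simp
    ring
  have e2 : Real.exp (a * b / T) * Real.exp (-(((b * (√u / √(T - u)) +
      a * (√(T - u) / √u)) / √T) ^ 2 / 2))
      = Real.exp (-((b ^ 2 * (u / (T - u)) + a ^ 2 * ((T - u) / u)) / (2 * T))) := by
    rw [← Real.exp_add, div_pow, s3]
    congr 1
    rw [← q1, ← q2]
    field_simp
    ring
  rw [← mul_assoc, ← mul_assoc, e1, e2]
  field_simp
  rw [s3]
  ring

lemma tendsto_hitPrimitive_right {T a b : ℝ} (hT : 0 < T) (hb : 0 < b) :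
    Tendsto (hitPrimitive T a b) (𝓝[<] T)
      (𝓝 (Real.exp (-(a * b / T)) * (√(2 * Real.pi) / 2)
        + Real.exp (a * b / T) * (√(2 * Real.pi) / 2))) := by
  have hv : Tendsto (fun u => √(T - u)) (𝓝[<] T) (𝓝[>] 0) := by
    refine tendsto_nhdsWithin_iff.2 ⟨?_, ?_⟩
    · have : Tendsto (fun u => √(T - u)) (𝓝 T) (𝓝 (√(T - T))) :=
        (Continuous.tendsto (by fun_prop) T)
      simpa using this.mono_left nhdsWithin_le_nhds
    · filter_upwards [self_mem_nhdsWithin] with u hu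
      exact Real.sqrt_pos.2 (sub_pos.2 hu)
  have hu : Tendsto (fun u => √u) (𝓝[<] T) (𝓝 (√T)) :=
    (Real.continuous_sqrt.tendsto T).mono_left nhdsWithin_le_nhds
  have p3 : 0 < √T := Real.sqrt_pos.2 hT
  have h1 : Tendsto (fun u => b * (√u / √(T - u))) (𝓝[<] T) atTop := by
    simp_rw [div_eq_mul_inv]
    exact (hu.pos_mul_atTop p3 (tendsto_inv_nhdsGT_zero.comp hv)).const_mul_atTop hb
  have h2 : Tendsto (fun u => a * (√(T - u) / √u)) (𝓝[<] T) (𝓝 (a * (0 / √T))) :=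
    ((tendsto_nhds_of_tendsto_nhdsWithin hv).div hu p3.ne').const_mul a
  have k1 := tendsto_integral_exp_neg_sq_half_atTop.comp
    ((h1.atTop_add h2.neg).atTop_div_const p3)
  have k2 := tendsto_integral_exp_neg_sq_half_atTop.comp ((h1.atTop_add h2).atTop_div_const p3)
  exact (k1.const_mul _).add (k2.const_mul _)

lemma tendsto_hitPrimitive_left {T a b : ℝ} (hT : 0 < T) (ha : 0 ≤ a) :
    Tendsto (hitPrimitive T a b) (𝓝[>] 0)
      (𝓝 (Real.exp (a * b / T) * (√(2 * Real.pi) / 2)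
        - Real.exp (-(a * b / T)) * (√(2 * Real.pi) / 2))) := by
  have hu : Tendsto (fun u => √u) (𝓝[>] 0) (𝓝[>] 0) := by
    refine tendsto_nhdsWithin_iff.2 ⟨?_, ?_⟩
    · have := Real.continuous_sqrt.tendsto 0
      rw [Real.sqrt_zero] at this
      exact this.mono_left nhdsWithin_le_nhds
    · filter_upwards [self_mem_nhdsWithin] with u hu
      exact Real.sqrt_pos.2 hu
  have hv : Tendsto (fun u => √(T - u)) (𝓝[>] 0) (𝓝 (√T)) := by
    have : Tendsto (fun u => √(T - u)) (𝓝 0) (𝓝 (√(T - 0))) :=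
      (Continuous.tendsto (by fun_prop) 0)
    rw [sub_zero] at this
    exact this.mono_left nhdsWithin_le_nhds
  have p3 : 0 < √T := Real.sqrt_pos.2 hT
  have h1 : Tendsto (fun u => b * (√u / √(T - u))) (𝓝[>] 0) (𝓝 (b * (0 / √T))) :=
    ((tendsto_nhds_of_tendsto_nhdsWithin hu).div hv p3.ne').const_mul b
  -- For `a = 0` the integration limits tend to `0` instead of `∓∞`; the stated limit is then `0`
  -- and the formula persists.
  rcases ha.eq_or_lt with rfl | ha
  · have hc : Continuous (fun w => ∫ m in (0 : ℝ)..w, Real.exp (-(m ^ 2 / 2))) :=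
      continuous_iff_continuousAt.2 fun w => (hasDerivAt_integral_exp_neg_sq_half w).continuousAt
    have h2 := (hc.tendsto _).comp (h1.div_const (√T))
    have h3 := (h2.const_mul 1).add (h2.const_mul 1)
    simp only [zero_div, mul_zero, intervalIntegral.integral_same, add_zero] at h3
    have e : hitPrimitive T 0 b = fun u => 1 * (∫ m in (0 : ℝ)..(b * (√u / √(T - u))) / √T,
        Real.exp (-(m ^ 2 / 2))) + 1 * (∫ m in (0 : ℝ)..(b * (√u / √(T - u))) / √T,
        Real.exp (-(m ^ 2 / 2))) := by
      ext u
      simp [hitPrimitive]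
    rw [e]
    simpa using h3
  · have h2 : Tendsto (fun u => a * (√(T - u) / √u)) (𝓝[>] 0) atTop := by
      simp_rw [div_eq_mul_inv]
      exact (hv.pos_mul_atTop p3 (tendsto_inv_nhdsGT_zero.comp hu)).const_mul_atTop ha
    have k1 := tendsto_integral_exp_neg_sq_half_atBot.comp
      ((h1.add_atBot (tendsto_neg_atTop_atBot.comp h2)).atBot_div_const p3)
    have k2 := tendsto_integral_exp_neg_sq_half_atTop.comp ((h1.add_atTop h2).atTop_div_const p3)
    rw [sub_eq_neg_add, ← mul_neg]
    exact (k1.const_mul (Real.exp (-(a * b / T)))).add (k2.const_mul (Real.exp (a * b / T)))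

/-- The exponents separate through `1/u = 1/T + (T-u)/(uT)` and `1/(T-u) = 1/T + u/((T-u)T)`. -/
lemma gaussKernel_mul_hitKernel_eq {T u : ℝ} (hu : 0 < u) (huT : u < T) (x y : ℝ) :
    gaussKernel u x * hitKernel (T - u) y = Real.exp (-((x ^ 2 + y ^ 2) / (2 * T)))
      / (2 * Real.pi * √T) * (|y| * √T * Real.exp (-((|y| ^ 2 * (u / (T - u)) +
        |x| ^ 2 * ((T - u) / u)) / (2 * T))) / (√u * (T - u) * √(T - u))) := by
  have hT : 0 < T := hu.trans huT
  have hv : 0 < T - u := sub_pos.2 huT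
  have hpi := Real.pi_pos
  have e : Real.exp (-(x ^ 2 / (2 * u))) * Real.exp (-(y ^ 2 / (2 * (T - u))))
      = Real.exp (-((x ^ 2 + y ^ 2) / (2 * T))) * Real.exp (-((|y| ^ 2 * (u / (T - u)) +
        |x| ^ 2 * ((T - u) / u)) / (2 * T))) := by
    rw [← Real.exp_add, ← Real.exp_add, sq_abs, sq_abs]
    congr 1
    field_simp
    ring
  have s : √(2 * Real.pi) ^ 2 = 2 * Real.pi := Real.sq_sqrt (by positivity)
  unfold hitKernel gaussKernel
  rw [Real.sqrt_mul (by positivity) u, Real.sqrt_mul (by positivity) (T - u)]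
  calc _ = (Real.exp (-(x ^ 2 / (2 * u))) * Real.exp (-(y ^ 2 / (2 * (T - u))))) * |y|
        / (√(2 * Real.pi) ^ 2 * √u * (T - u) * √(T - u)) := by field_simp
    _ = _ := by
      rw [e, s]
      field_simp

/-- First-passage decomposition of the heat kernel. -/
lemma integral_gaussKernel_mul_hitKernel {T : ℝ} (hT : 0 < T) (x : ℝ) {y : ℝ} (hy : y ≠ 0) :
    IntegrableOn (fun u => gaussKernel u x * hitKernel (T - u) y) (Ioo 0 T) ∧
      ∫ u in Ioo 0 T, gaussKernel u x * hitKernel (T - u) y = gaussKernel T (|x| + |y|) := by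
  have hpi := Real.pi_pos
  have hb : 0 < |y| := abs_pos.2 hy
  have hl := tendsto_hitPrimitive_left (b := |y|) hT (abs_nonneg x)
  have hr := tendsto_hitPrimitive_right (a := |x|) hT hb
  set D : ℝ → ℝ := fun u => |y| * √T * Real.exp (-((|y| ^ 2 * (u / (T - u)) +
        |x| ^ 2 * ((T - u) / u)) / (2 * T))) / (√u * (T - u) * √(T - u)) with hD
  have hd : ∀ u ∈ Ioo 0 T, HasDerivAt (hitPrimitive T |x| |y|) (D u) u :=
    fun u hu => hasDerivAt_hitPrimitive hu.1 hu.2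
  have hD0 : ∀ u ∈ Ioo 0 T, 0 ≤ D u := by
    intro u hu
    have := sub_pos.2 hu.2
    simp only [hD]
    positivity
  -- A nonnegative derivative whose primitive has finite limits at both ends is integrable; the
  -- primitive is extended continuously to `[0,T]` by those limits.
  have hi : IntegrableOn D (Ioo 0 T) := by
    have hcont := continuousOn_Icc_extendFrom_Ioo
      (fun u hu => (hd u hu).continuousAt.continuousWithinAt) hl hr
    refine (intervalIntegral.integrableOn_deriv_of_nonneg hcont (fun u hu => ?_) hD0).mono_set
      Ioo_subset_Ioc_self
    refine (hd u hu).congr_of_eventuallyEq ?_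
    filter_upwards [isOpen_Ioo.mem_nhds hu] with w hw
    exact extendFrom_eq (subset_closure hw)
      ((hd w hw).continuousAt.tendsto.mono_left nhdsWithin_le_nhds)
  -- The `exp (ab/T)` terms of the two boundary limits cancel, and the `exp (-ab/T)` terms add up.
  have hI : ∫ u in Ioo 0 T, D u = 2 * (Real.exp (-(|x| * |y| / T)) * (√(2 * Real.pi) / 2)) := by
    rw [← integral_Ioc_eq_integral_Ioo, ← intervalIntegral.integral_of_le hT.le,
      intervalIntegral.integral_eq_sub_of_hasDerivAt_of_tendsto hT hd
        ((intervalIntegrable_iff_integrableOn_Ioo_of_le hT.le).2 hi) hl hr]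
    ring
  have hc : EqOn (fun u => gaussKernel u x * hitKernel (T - u) y)
      (fun u => Real.exp (-((x ^ 2 + y ^ 2) / (2 * T))) / (2 * Real.pi * √T) * D u) (Ioo 0 T) :=
    fun u hu => gaussKernel_mul_hitKernel_eq hu.1 hu.2 x y
  refine ⟨(integrableOn_congr_fun hc measurableSet_Ioo).2 (hi.const_mul _), ?_⟩
  rw [setIntegral_congr_fun measurableSet_Ioo hc, integral_const_mul, hI, gaussKernel,
    Real.sqrt_mul (by positivity) T]
  have s : √(2 * Real.pi) ^ 2 = 2 * Real.pi := Real.sq_sqrt (by positivity)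
  have e : Real.exp (-((|x| + |y|) ^ 2 / (2 * T))) = Real.exp (-((x ^ 2 + y ^ 2) / (2 * T)))
      * Real.exp (-(|x| * |y| / T)) := by
    rw [← Real.exp_add, ← sq_abs x, ← sq_abs y]
    congr 1
    field_simp
    ring
  rw [e]
  have : 0 < √(2 * Real.pi) := by positivity
  have : 0 < √T := Real.sqrt_pos.2 hT
  field_simp
  rw [s]

/-! ### Convergence, positivity and measurability of the density -/

lemma measurable_real_sign : Measurable Real.sign := by
  unfold Real.sign
  exact Measurable.ite measurableSet_Iio measurable_const
    (Measurable.ite measurableSet_Ioi measurable_const measurable_const)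

lemma rpow_three_halves {x : ℝ} (hx : 0 < x) : x ^ ((3 : ℝ) / 2) = x * √x := by
  rw [Real.sqrt_eq_rpow, show (3 : ℝ) / 2 = 1 + 1 / 2 by norm_num, Real.rpow_add hx,
    Real.rpow_one]

/-- The two Gaussian normalisations contribute `1/(2π)`, which is the constant `1/2 * 1/π` of the
definition. This factored form isolates the dependence on each endpoint. -/
lemma crossingIntegrand_eq (β : ℝ≥0 → ℝ) (s t : ℝ≥0) (x y : ℝ) {u : ℝ}
    (hu : u ∈ Ioo (0 : ℝ) ((t : ℝ) - s)) :
    crossingIntegrand β s t x y u = (1 + Real.sign y * β (s + u.toNNReal)) *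
      (gaussKernel u x * hitKernel ((t : ℝ) - s - u) y) := by
  have h1 : 0 < u := hu.1
  have h2 : 0 < (t : ℝ) - s - u := sub_pos.2 hu.2
  have hpi := Real.pi_pos
  have e : √(2 * Real.pi) ^ 2 = 2 * Real.pi := Real.sq_sqrt (by positivity)
  rw [crossingIntegrand, shift, rpow_three_halves h2, hitKernel, gaussKernel, gaussKernel,
    Real.sqrt_mul (by positivity) u, Real.sqrt_mul (by positivity) ((t : ℝ) - s - u), ← sub_sub]
  have : 0 < √(2 * Real.pi) := by positivity
  field_simp
  rw [e]
  ring

lemma measurable_crossingIntegrand {β : ℝ≥0 → ℝ} (hβ : Measurable β) (s t : ℝ≥0) :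
    Measurable (fun q : (ℝ × ℝ) × ℝ => crossingIntegrand β s t q.1.1 q.1.2 q.2) := by
  unfold crossingIntegrand shift
  have h1 : Measurable (fun q : (ℝ × ℝ) × ℝ => Real.sign q.1.2) :=
    measurable_real_sign.comp (by fun_prop)
  have h2 : Measurable (fun q : (ℝ × ℝ) × ℝ => β (s + q.2.toNNReal)) :=
    hβ.comp (measurable_const.add (measurable_real_toNNReal.comp measurable_snd))
  fun_prop

lemma abs_sign_mul_le {b : ℝ} (hb : b ∈ Icc (-1 : ℝ) 1) (y : ℝ) : |Real.sign y * b| ≤ 1 := by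
  rw [abs_mul]
  have h1 : |b| ≤ 1 := abs_le.2 hb
  have h2 : |Real.sign y| ≤ 1 := by
    rcases Real.sign_apply_eq y with h | h | h <;> simp [h]
  nlinarith [abs_nonneg b, abs_nonneg (Real.sign y)]

lemma one_add_sign_mul_nonneg {b : ℝ} (hb : b ∈ Icc (-1 : ℝ) 1) (y : ℝ) :
    0 ≤ 1 + Real.sign y * b := by
  linarith [(abs_le.1 (abs_sign_mul_le hb y)).1]

section

variable {β : ℝ≥0 → ℝ}

lemma crossingIntegrand_nonneg (hβ1 : ∀ r, β r ∈ Icc (-1 : ℝ) 1) (s t : ℝ≥0) (x y : ℝ) {u : ℝ}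
    (hu : u ∈ Ioo (0 : ℝ) ((t : ℝ) - s)) : 0 ≤ crossingIntegrand β s t x y u := by
  rw [crossingIntegrand_eq β s t x y hu]
  exact mul_nonneg (one_add_sign_mul_nonneg (hβ1 _) y)
    (mul_nonneg (gaussKernel_nonneg _ _) (hitKernel_nonneg (sub_pos.2 hu.2).le _))

lemma integrableOn_crossingIntegrand (hβ : Measurable β) (hβ1 : ∀ r, β r ∈ Icc (-1 : ℝ) 1)
    {s t : ℝ≥0} (hst : s < t) (x y : ℝ) :
    IntegrableOn (crossingIntegrand β s t x y) (Ioo 0 ((t : ℝ) - s)) := by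
  have hT : (0 : ℝ) < (t : ℝ) - s := sub_pos.2 (by exact_mod_cast hst)
  -- The first-passage identity fails at `y = 0`, where the integrand vanishes. Elsewhere `1 +
  -- sgn(y) β ≤ 2` gives domination by twice its integrand.
  by_cases hy : y = 0
  · subst hy
    have : crossingIntegrand β s t x 0 = fun _ => 0 := by
      ext u
      simp [crossingIntegrand]
    rw [this]
    exact integrableOn_zero
  · have h := (integral_gaussKernel_mul_hitKernel hT x hy).1.const_mul 2
    refine Integrable.mono' h ((measurable_crossingIntegrand hβ s t).comp
      (measurable_prodMk_left (x := (x, y)))).aestronglyMeasurable ?_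
    filter_upwards [ae_restrict_mem measurableSet_Ioo] with u hu
    rw [Real.norm_of_nonneg (crossingIntegrand_nonneg hβ1 s t x y hu),
      crossingIntegrand_eq β s t x y hu]
    refine mul_le_mul_of_nonneg_right ?_
      (mul_nonneg (gaussKernel_nonneg _ _) (hitKernel_nonneg (sub_pos.2 hu.2).le _))
    linarith [(abs_le.1 (abs_sign_mul_le (hβ1 (s + u.toNNReal)) y)).2]

lemma density_eq {s t : ℝ≥0} (hst : s < t) (x y : ℝ) :
    density β s t x y = (∫ u in Ioo 0 ((t : ℝ) - s), crossingIntegrand β s t x y u)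
      + killedKernel ((t : ℝ) - s) x y := by
  have hT : (0 : ℝ) < (t : ℝ) - s := sub_pos.2 (by exact_mod_cast hst)
  rw [density, killedDensity_eq, intervalIntegral.integral_of_le hT.le,
    integral_Ioc_eq_integral_Ioo]

lemma setIntegral_crossingIntegrand_nonneg (hβ1 : ∀ r, β r ∈ Icc (-1 : ℝ) 1) (s t : ℝ≥0)
    (x y : ℝ) : 0 ≤ ∫ u in Ioo 0 ((t : ℝ) - s), crossingIntegrand β s t x y u :=
  setIntegral_nonneg measurableSet_Ioo fun _ hu => crossingIntegrand_nonneg hβ1 s t x y hu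

lemma density_nonneg (hβ1 : ∀ r, β r ∈ Icc (-1 : ℝ) 1) {s t : ℝ≥0} (hst : s < t) (x y : ℝ) :
    0 ≤ density β s t x y := by
  rw [density_eq hst]
  exact add_nonneg (setIntegral_crossingIntegrand_nonneg hβ1 s t x y)
    (killedKernel_nonneg (sub_pos.2 (by exact_mod_cast hst)) x y)

lemma ofReal_density (hβ : Measurable β) (hβ1 : ∀ r, β r ∈ Icc (-1 : ℝ) 1) {s t : ℝ≥0}
    (hst : s < t) (x y : ℝ) :
    ENNReal.ofReal (density β s t x y)
      = (∫⁻ u in Ioo 0 ((t : ℝ) - s), ENNReal.ofReal (crossingIntegrand β s t x y u))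
        + ENNReal.ofReal (killedKernel ((t : ℝ) - s) x y) := by
  rw [density_eq hst, ENNReal.ofReal_add (setIntegral_crossingIntegrand_nonneg hβ1 s t x y)
    (killedKernel_nonneg (sub_pos.2 (by exact_mod_cast hst)) x y),
    ofReal_integral_eq_lintegral_ofReal (integrableOn_crossingIntegrand hβ hβ1 hst x y)]
  filter_upwards [ae_restrict_mem measurableSet_Ioo] with u hu
  exact crossingIntegrand_nonneg hβ1 s t x y hu

lemma measurable_density (hβ : Measurable β) {s t : ℝ≥0} (hst : s < t) :
    Measurable (fun q : ℝ × ℝ => density β s t q.1 q.2) := by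
  simp_rw [density_eq hst]
  refine Measurable.add ?_ (measurable_killedKernel _)
  exact ((measurable_crossingIntegrand hβ s t).stronglyMeasurable.integral_prod_right').measurable

lemma measurable_density_right (hβ : Measurable β) {s t : ℝ≥0} (hst : s < t) (x : ℝ) :
    Measurable (density β s t x) :=
  Measurable.of_uncurry_left (f := density β s t) (measurable_density hβ hst)

lemma measurable_density_left (hβ : Measurable β) {s t : ℝ≥0} (hst : s < t) (y : ℝ) :
    Measurable (fun x => density β s t x y) :=
  Measurable.of_uncurry_right (f := density β s t) (measurable_density hβ hst)

/-! ### Symmetrisation in the final point -/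

/-- `sgn` is odd and `hitKernel` even, so `β` drops out and the crossing parts sum to `2
g_T(|x|+|y|)`. For `x ≠ 0` exactly one of `y`, `-y` lies on the side of `x`, and its killed term
trades one copy of `g_T(|x|+|y|)` for `g_T(|x|-|y|)`. -/
lemma density_add_density_neg (hβ : Measurable β) (hβ1 : ∀ r, β r ∈ Icc (-1 : ℝ) 1) {s t : ℝ≥0}
    (hst : s < t) (x : ℝ) {y : ℝ} (hy : y ≠ 0) :
    density β s t x y + density β s t x (-y)
      = gaussKernel ((t : ℝ) - s) (y - x) + gaussKernel ((t : ℝ) - s) (-y - x) := by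
  have hT : (0 : ℝ) < (t : ℝ) - s := sub_pos.2 (by exact_mod_cast hst)
  have h1 : (∫ u in Ioo 0 ((t : ℝ) - s), crossingIntegrand β s t x y u)
      + (∫ u in Ioo 0 ((t : ℝ) - s), crossingIntegrand β s t x (-y) u)
      = 2 * gaussKernel ((t : ℝ) - s) (|x| + |y|) := by
    rw [← integral_add (integrableOn_crossingIntegrand hβ hβ1 hst x y)
      (integrableOn_crossingIntegrand hβ hβ1 hst x (-y)),
      ← (integral_gaussKernel_mul_hitKernel hT x hy).2, ← integral_const_mul]
    refine setIntegral_congr_fun measurableSet_Ioo fun u hu => ?_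
    simp only [crossingIntegrand_eq β s t x _ hu, hitKernel_neg, Real.sign_neg]
    ring
  have h2 : gaussKernel ((t : ℝ) - s) (-y - x) = gaussKernel ((t : ℝ) - s) (y + x) := by
    rw [← gaussKernel_neg, neg_sub, sub_neg_eq_add, add_comm]
  rw [density_eq hst, density_eq hst, add_add_add_comm, h1, killedKernel, killedKernel, h2]
  rcases lt_trichotomy x 0 with hx | rfl | hx
  · rcases lt_or_gt_of_ne hy with hy | hy
    · rw [if_pos (mul_pos_of_neg_of_neg hx hy), if_neg (by nlinarith), abs_of_neg hx,
        abs_of_neg hy, ← neg_add, gaussKernel_neg, add_comm x y]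
      ring
    · rw [if_neg (by nlinarith), if_pos (by nlinarith), abs_of_neg hx, abs_of_pos hy,
        neg_add_eq_sub, ← gaussKernel_neg _ (-y + x), neg_add, neg_neg, ← sub_eq_add_neg]
      ring
  · simp only [zero_mul, lt_irrefl, if_false, abs_zero, zero_add, add_zero, sub_zero]
    rcases abs_choice y with h | h <;> rw [h] <;> (try rw [gaussKernel_neg]) <;> ring
  · rcases lt_or_gt_of_ne hy with hy | hy
    · rw [if_neg (by nlinarith), if_pos (by nlinarith), abs_of_pos hx, abs_of_neg hy,
        ← sub_eq_add_neg, gaussKernel_sub_comm _ x y, ← gaussKernel_neg _ (-y + x), neg_add,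
        neg_neg, ← sub_eq_add_neg]
      ring
    · rw [if_pos (mul_pos hx hy), if_neg (by nlinarith), abs_of_pos hx, abs_of_pos hy,
        add_comm x y]
      ring

/-- Reflection invariance makes each symmetrised integral twice the original. The factor `2` cancels
in `ℝ≥0∞` even when the integrals are infinite. -/
lemma lintegral_eq_of_add_neg_eq {f g : ℝ → ℝ≥0∞} (hf : Measurable f) (hg : Measurable g)
    (h : ∀ y, y ≠ 0 → f y + f (-y) = g y + g (-y)) : ∫⁻ y, f y = ∫⁻ y, g y := by
  have e : ∀ f : ℝ → ℝ≥0∞, Measurable f → ∫⁻ y, (f y + f (-y)) = 2 * ∫⁻ y, f y := by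
    intro f hf
    rw [lintegral_add_left hf, (Measure.measurePreserving_neg volume).lintegral_comp hf, two_mul]
  have h' : ∫⁻ y, (f y + f (-y)) = ∫⁻ y, (g y + g (-y)) := by
    refine lintegral_congr_ae ?_
    filter_upwards [compl_mem_ae_iff.2 (measure_singleton (0 : ℝ))] with y hy
    exact h y hy
  rw [e f hf, e g hg] at h'
  exact (ENNReal.mul_right_inj two_ne_zero ENNReal.ofNat_ne_top).1 h'

/-- Integrals of even functions against the skew density do not depend on the skewness. -/
lemma lintegral_density_mul_even (hβ : Measurable β) (hβ1 : ∀ r, β r ∈ Icc (-1 : ℝ) 1)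
    {s t : ℝ≥0} (hst : s < t) (x : ℝ) {φ : ℝ → ℝ≥0∞} (hφ : Measurable φ)
    (heven : ∀ y, φ (-y) = φ y) :
    ∫⁻ y, ENNReal.ofReal (density β s t x y) * φ y
      = ∫⁻ y, ENNReal.ofReal (gaussKernel ((t : ℝ) - s) (y - x)) * φ y := by
  have m1 : Measurable fun y => density β s t x y :=
    measurable_density_right hβ hst x
  have m2 : Measurable fun y => gaussKernel ((t : ℝ) - s) (y - x) := by
    unfold gaussKernel
    fun_prop
  refine lintegral_eq_of_add_neg_eq (m1.ennreal_ofReal.mul hφ) (m2.ennreal_ofReal.mul hφ) ?_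
  intro y hy
  rw [heven, ← add_mul, ← add_mul, ← ENNReal.ofReal_add (density_nonneg hβ1 hst x y)
    (density_nonneg hβ1 hst x (-y)), ← ENNReal.ofReal_add (gaussKernel_nonneg _ _)
    (gaussKernel_nonneg _ _), density_add_density_neg hβ hβ1 hst x hy]

lemma lintegral_density (hβ : Measurable β) (hβ1 : ∀ r, β r ∈ Icc (-1 : ℝ) 1)
    {s t : ℝ≥0} (hst : s < t) (x : ℝ) : ∫⁻ y, ENNReal.ofReal (density β s t x y) = 1 := by
  have hT : (0 : ℝ) < (t : ℝ) - s := sub_pos.2 (by exact_mod_cast hst)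
  have h := lintegral_density_mul_even hβ hβ1 hst x (φ := fun _ => 1) measurable_const
    (fun _ => rfl)
  simp only [mul_one] at h
  rw [h, ← ofReal_integral_eq_lintegral_ofReal (integrable_gaussKernel_sub hT x)
    (Filter.Eventually.of_forall fun _ => gaussKernel_nonneg _ _), integral_gaussKernel_sub hT x,
    ENNReal.ofReal_one]

lemma lintegral_density_mul_gaussKernel (hβ : Measurable β) (hβ1 : ∀ r, β r ∈ Icc (-1 : ℝ) 1)
    {s t : ℝ≥0} (hst : s < t) (x : ℝ) {w : ℝ} (hw : 0 < w) :
    ∫⁻ y, ENNReal.ofReal (density β s t x y) * ENNReal.ofReal (gaussKernel w y)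
      = ENNReal.ofReal (gaussKernel ((t : ℝ) - s + w) x) := by
  have hT : (0 : ℝ) < (t : ℝ) - s := sub_pos.2 (by exact_mod_cast hst)
  rw [lintegral_density_mul_even hβ hβ1 hst x
    (by unfold gaussKernel; fun_prop) (fun y => by rw [gaussKernel_neg])]
  have h1 := integrable_gaussKernel_mul hT hw x 0
  have h2 := integral_gaussKernel_mul hT hw x 0
  simp only [sub_zero, zero_sub, gaussKernel_neg] at h1 h2
  simp_rw [← ENNReal.ofReal_mul (gaussKernel_nonneg _ _)]
  rw [← h2, ofReal_integral_eq_lintegral_ofReal h1 (Filter.Eventually.of_forall fun _ =>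
    mul_nonneg (gaussKernel_nonneg _ _) (gaussKernel_nonneg _ _))]

/-! ### Chapman–Kolmogorov, split by the last zero -/

/-- Last zero after the intermediate time: for fixed `w` only `gaussKernel w y` depends on `y`, and
integrating it against the density gives `gaussKernel (t - s + w) x`. Time `w` since `t` becomes `t
- s + w` since `s`. -/
lemma lintegral_density_mul_crossing (hβ : Measurable β) (hβ1 : ∀ r, β r ∈ Icc (-1 : ℝ) 1)
    {s t v : ℝ≥0} (hst : s < t) (x z : ℝ) :
    ∫⁻ y, ENNReal.ofReal (density β s t x y) *
        ∫⁻ w in Ioo 0 ((v : ℝ) - t), ENNReal.ofReal (crossingIntegrand β t v y z w)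
      = ∫⁻ w in Ioo 0 ((v : ℝ) - t),
        ENNReal.ofReal (crossingIntegrand β s v x z ((t : ℝ) - s + w)) := by
  have hT : (0 : ℝ) < (t : ℝ) - s := sub_pos.2 (by exact_mod_cast hst)
  have m1 : Measurable fun y => density β s t x y :=
    measurable_density_right hβ hst x
  have m2 : Measurable fun q : ℝ × ℝ => crossingIntegrand β t v q.1 z q.2 :=
    (measurable_crossingIntegrand hβ t v).comp
      (((measurable_fst).prodMk measurable_const).prodMk measurable_snd)
  calc _ = ∫⁻ y, ∫⁻ w in Ioo 0 ((v : ℝ) - t), ENNReal.ofReal (density β s t x y) *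
        ENNReal.ofReal (crossingIntegrand β t v y z w) := by
        refine lintegral_congr fun y => ?_
        rw [lintegral_const_mul]
        exact (m2.comp measurable_prodMk_left).ennreal_ofReal
    _ = ∫⁻ w in Ioo 0 ((v : ℝ) - t), ∫⁻ y, ENNReal.ofReal (density β s t x y) *
        ENNReal.ofReal (crossingIntegrand β t v y z w) := by
        refine lintegral_lintegral_swap (Measurable.aemeasurable ?_)
        exact (m1.comp measurable_fst).ennreal_ofReal.mul m2.ennreal_ofReal
    _ = _ := by
        refine setLIntegral_congr_fun measurableSet_Ioo fun w hw => ?_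
        have hc : 0 ≤ (1 + Real.sign z * β (t + w.toNNReal)) * hitKernel ((v : ℝ) - t - w) z :=
          mul_nonneg (one_add_sign_mul_nonneg (hβ1 _) z) (hitKernel_nonneg (sub_pos.2 hw.2).le _)
        have e : ∀ y, crossingIntegrand β t v y z w = (1 + Real.sign z * β (t + w.toNNReal)) *
            hitKernel ((v : ℝ) - t - w) z * gaussKernel w y := by
          intro y
          rw [crossingIntegrand_eq β t v y z hw]
          ring
        have hw' : (t : ℝ) - s + w ∈ Ioo (0 : ℝ) ((v : ℝ) - s) :=
          ⟨add_pos hT hw.1, by linarith [hw.2]⟩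
        -- Both descriptions of the zero evaluate `β` at the same absolute time.
        have ht : s + ((t : ℝ) - s + w).toNNReal = t + w.toNNReal := by
          ext
          push_cast
          rw [Real.coe_toNNReal _ hw'.1.le, Real.coe_toNNReal _ hw.1.le]
          ring
        simp only [e]
        calc _ = ∫⁻ y, ENNReal.ofReal ((1 + Real.sign z * β (t + w.toNNReal)) *
              hitKernel ((v : ℝ) - t - w) z) * (ENNReal.ofReal (density β s t x y) *
              ENNReal.ofReal (gaussKernel w y)) := by
              refine lintegral_congr fun y => ?_
              rw [ENNReal.ofReal_mul hc]
              ring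
          _ = _ := by
              rw [lintegral_const_mul, lintegral_density_mul_gaussKernel hβ hβ1 hst x hw.1,
                ← ENNReal.ofReal_mul hc, crossingIntegrand_eq β s v x z hw', ht,
                show (v : ℝ) - s - (t - s + w) = v - t - w by ring]
              · congr 1
                ring
              · refine m1.ennreal_ofReal.mul ?_
                unfold gaussKernel
                fun_prop

/-- Last zero before the intermediate time: the killed kernel carries `hitKernel (t - s - u)` to
`hitKernel (v - s - u)` by the entrance law, leaving `u` and the bias unchanged. -/
lemma lintegral_crossing_mul_killedKernel (hβ : Measurable β) (hβ1 : ∀ r, β r ∈ Icc (-1 : ℝ) 1)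
    {s t v : ℝ≥0} (htv : t < v) (x z : ℝ) :
    ∫⁻ y, (∫⁻ u in Ioo 0 ((t : ℝ) - s), ENNReal.ofReal (crossingIntegrand β s t x y u)) *
        ENNReal.ofReal (killedKernel ((v : ℝ) - t) y z)
      = ∫⁻ u in Ioo 0 ((t : ℝ) - s), ENNReal.ofReal (crossingIntegrand β s v x z u) := by
  have hV : (0 : ℝ) < (v : ℝ) - t := sub_pos.2 (by exact_mod_cast htv)
  have m1 : Measurable fun y => killedKernel ((v : ℝ) - t) y z :=
    (measurable_killedKernel _).comp measurable_prodMk_right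
  have m2 : Measurable fun q : ℝ × ℝ => crossingIntegrand β s t x q.1 q.2 :=
    (measurable_crossingIntegrand hβ s t).comp
      ((measurable_const.prodMk measurable_fst).prodMk measurable_snd)
  calc _ = ∫⁻ y, ∫⁻ u in Ioo 0 ((t : ℝ) - s), ENNReal.ofReal (crossingIntegrand β s t x y u) *
        ENNReal.ofReal (killedKernel ((v : ℝ) - t) y z) := by
        refine lintegral_congr fun y => ?_
        rw [lintegral_mul_const]
        exact (m2.comp measurable_prodMk_left).ennreal_ofReal
    _ = ∫⁻ u in Ioo 0 ((t : ℝ) - s), ∫⁻ y, ENNReal.ofReal (crossingIntegrand β s t x y u) *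
        ENNReal.ofReal (killedKernel ((v : ℝ) - t) y z) := by
        refine lintegral_lintegral_swap (Measurable.aemeasurable ?_)
        exact m2.ennreal_ofReal.mul (m1.comp measurable_fst).ennreal_ofReal
    _ = _ := by
        refine setLIntegral_congr_fun measurableSet_Ioo fun u hu => ?_
        have hτ : 0 < (t : ℝ) - s - u := sub_pos.2 hu.2
        have hc : 0 ≤ (1 + Real.sign z * β (s + u.toNNReal)) * gaussKernel u x :=
          mul_nonneg (one_add_sign_mul_nonneg (hβ1 _) z) (gaussKernel_nonneg _ _)
        have hu' : u ∈ Ioo (0 : ℝ) ((v : ℝ) - s) := ⟨hu.1, by linarith [hu.2]⟩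
        have e : ∀ y, ENNReal.ofReal (crossingIntegrand β s t x y u) *
            ENNReal.ofReal (killedKernel ((v : ℝ) - t) y z)
            = ENNReal.ofReal ((1 + Real.sign z * β (s + u.toNNReal)) * gaussKernel u x) *
              ENNReal.ofReal (hitKernel ((t : ℝ) - s - u) y *
                killedKernel ((v : ℝ) - t) y z) := by
          intro y
          rw [← ENNReal.ofReal_mul (crossingIntegrand_nonneg hβ1 s t x y hu),
            ← ENNReal.ofReal_mul hc, crossingIntegrand_eq β s t x y hu]
          -- On the support of the killed kernel `y` and `z` have the same sign, so the bias depends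
          -- on `z` only and leaves the `y`-integral.
          by_cases hyz : 0 < y * z
          · have hs : Real.sign y = Real.sign z := by
              rcases mul_pos_iff.1 hyz with ⟨h1, h2⟩ | ⟨h1, h2⟩
              · rw [Real.sign_of_pos h1, Real.sign_of_pos h2]
              · rw [Real.sign_of_neg h1, Real.sign_of_neg h2]
            rw [hs]
            congr 1
            ring
          · simp [killedKernel, hyz]
        obtain ⟨h1, h2⟩ := integral_hitKernel_mul_killedKernel hτ hV z
        simp only [e]
        rw [lintegral_const_mul' _ _ ENNReal.ofReal_ne_top, ← ofReal_integral_eq_lintegral_ofReal h1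
          (Filter.Eventually.of_forall fun y =>
            mul_nonneg (hitKernel_nonneg hτ.le y) (killedKernel_nonneg hV y z)), h2,
          ← ENNReal.ofReal_mul hc, crossingIntegrand_eq β s v x z hu',
          show (t : ℝ) - s - u + (v - t) = v - s - u by ring]
        congr 1
        ring

lemma setLIntegral_Ioo_add {a b : ℝ} (ha : 0 < a) (hb : 0 < b) (f : ℝ → ℝ≥0∞) :
    ∫⁻ u in Ioo 0 (a + b), f u = (∫⁻ u in Ioo 0 a, f u) + ∫⁻ w in Ioo 0 b, f (a + w) := by
  have h1 : Ioo 0 (a + b) = Ioo 0 a ∪ Ico a (a + b) :=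
    (Ioo_union_Ico_eq_Ioo ha (by linarith)).symm
  have h2 : ∫⁻ u in Ioo a (a + b), f u = ∫⁻ w in Ioo 0 b, f (a + w) := by
    rw [← lintegral_indicator measurableSet_Ioo, ← lintegral_indicator measurableSet_Ioo,
      ← lintegral_add_left_eq_self _ a]
    refine lintegral_congr fun w => ?_
    simp only [indicator, mem_Ioo, lt_add_iff_pos_right, add_lt_add_iff_left]
  rw [h1, lintegral_union measurableSet_Ico, ← h2, setLIntegral_congr Ioo_ae_eq_Ico.symm]
  exact disjoint_left.2 fun u hu hu' => absurd hu.2 (not_lt.2 hu'.1)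

/-- The Chapman–Kolmogorov equation for the densities, as a Lebesgue integral. -/
lemma lintegral_density_mul_density (hβ : Measurable β) (hβ1 : ∀ r, β r ∈ Icc (-1 : ℝ) 1)
    {s t v : ℝ≥0} (hst : s < t) (htv : t < v) (x z : ℝ) :
    ∫⁻ y, ENNReal.ofReal (density β s t x y) * ENNReal.ofReal (density β t v y z)
      = ENNReal.ofReal (density β s v x z) := by
  have hT : (0 : ℝ) < (t : ℝ) - s := sub_pos.2 (by exact_mod_cast hst)
  have hV : (0 : ℝ) < (v : ℝ) - t := sub_pos.2 (by exact_mod_cast htv)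
  have m1 : Measurable fun y => density β s t x y :=
    measurable_density_right hβ hst x
  have m2 : Measurable fun y => killedKernel ((v : ℝ) - t) y z :=
    (measurable_killedKernel _).comp measurable_prodMk_right
  have m3 : Measurable fun y => killedKernel ((t : ℝ) - s) x y :=
    (measurable_killedKernel _).comp measurable_prodMk_left
  have n1 : Measurable fun y => ENNReal.ofReal (killedKernel ((t : ℝ) - s) x y) *
      ENNReal.ofReal (killedKernel ((v : ℝ) - t) y z) := m3.ennreal_ofReal.mul m2.ennreal_ofReal
  have n2 : Measurable fun y => ENNReal.ofReal (density β s t x y) *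
      ENNReal.ofReal (killedKernel ((v : ℝ) - t) y z) := m1.ennreal_ofReal.mul m2.ennreal_ofReal
  obtain ⟨k1, k2⟩ := integral_killedKernel_mul_killedKernel hT hV x z
  have h1 : ∫⁻ y, ENNReal.ofReal (density β s t x y) *
      ENNReal.ofReal (killedKernel ((v : ℝ) - t) y z)
      = (∫⁻ u in Ioo 0 ((t : ℝ) - s), ENNReal.ofReal (crossingIntegrand β s v x z u))
        + ENNReal.ofReal (killedKernel ((v : ℝ) - s) x z) := by
    simp_rw [ofReal_density hβ hβ1 hst, add_mul]
    rw [lintegral_add_right _ n1,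
      lintegral_crossing_mul_killedKernel hβ hβ1 htv,
      show (v : ℝ) - s = (t - s) + (v - t) by ring, ← k2,
      ofReal_integral_eq_lintegral_ofReal k1 (Filter.Eventually.of_forall fun y =>
        mul_nonneg (killedKernel_nonneg hT x y) (killedKernel_nonneg hV y z))]
    simp_rw [← ENNReal.ofReal_mul (killedKernel_nonneg hT _ _)]
  -- The two crossing contributions cover last-zero times in `(0, t - s)` and `(t - s, v - s)`; the
  -- missing point is null.
  simp_rw [ofReal_density hβ hβ1 htv, mul_add]
  rw [lintegral_add_right _ n2,
    lintegral_density_mul_crossing hβ hβ1 hst, h1, ofReal_density hβ hβ1 (hst.trans htv),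
    show Ioo 0 ((v : ℝ) - s) = Ioo 0 ((t - s) + (v - t) : ℝ) by congr 1; ring,
    setLIntegral_Ioo_add hT hV]
  ring

/-! ### The family of transition probabilities -/

lemma transitionMeasure_apply (s t : ℝ≥0) (x : ℝ) {A : Set ℝ} (hA : MeasurableSet A) :
    transitionMeasure β s t x A = ∫⁻ y in A, ENNReal.ofReal (density β s t x y) :=
  withDensity_apply _ hA

lemma measurable_transitionMeasure (hβ : Measurable β) {s t : ℝ≥0} (hst : s < t) {A : Set ℝ}
    (hA : MeasurableSet A) : Measurable fun x => transitionMeasure β s t x A := by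
  simp_rw [transitionMeasure_apply s t _ hA]
  exact (measurable_density hβ hst).ennreal_ofReal.lintegral_prod_right'

lemma isTransitionFunction_transitionMeasure (hβ : Measurable β)
    (hβ1 : ∀ r, β r ∈ Icc (-1 : ℝ) 1) : IsTransitionFunction (transitionMeasure β) where
  isProbabilityMeasure s t hst x := by
    constructor
    rw [transitionMeasure_apply s t x MeasurableSet.univ, setLIntegral_univ,
      lintegral_density hβ hβ1 hst]
  measurable s t hst A hA := measurable_transitionMeasure hβ hst hA
  comp s t v hst htv x A hA := by
    have m1 : Measurable fun y => ENNReal.ofReal (density β s t x y) :=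
      (measurable_density_right hβ hst x).ennreal_ofReal
    have m2 : Measurable fun q : ℝ × ℝ => ENNReal.ofReal (density β t v q.1 q.2) :=
      (measurable_density hβ htv).ennreal_ofReal
    rw [transitionMeasure, lintegral_withDensity_eq_lintegral_mul _ m1
      (measurable_transitionMeasure hβ htv hA), transitionMeasure_apply s v x hA]
    -- Tonelli reduces composition of the kernels to the pointwise identity for the densities.
    calc _ = ∫⁻ y, ∫⁻ z in A, ENNReal.ofReal (density β s t x y) *
          ENNReal.ofReal (density β t v y z) := by
          refine lintegral_congr fun y => ?_
          rw [Pi.mul_apply, transitionMeasure_apply t v y hA, lintegral_const_mul]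
          exact (measurable_density_right hβ htv y).ennreal_ofReal
      _ = ∫⁻ z in A, ∫⁻ y, ENNReal.ofReal (density β s t x y) *
          ENNReal.ofReal (density β t v y z) :=
          lintegral_lintegral_swap ((m1.comp measurable_fst).mul m2).aemeasurable
      _ = _ := by
          simp_rw [lintegral_density_mul_density hβ hβ1 hst htv]

lemma integral_density_mul_density (hβ : Measurable β) (hβ1 : ∀ r, β r ∈ Icc (-1 : ℝ) 1)
    {s t v : ℝ≥0} (hst : s < t) (htv : t < v) (x z : ℝ) :
    Integrable (fun y => density β s t x y * density β t v y z) ∧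
      ∫ y, density β s t x y * density β t v y z = density β s v x z := by
  have m1 : Measurable fun y => density β s t x y :=
    measurable_density_right hβ hst x
  have m2 : Measurable fun y => density β t v y z :=
    measurable_density_left hβ htv z
  have h0 : 0 ≤ᵐ[volume] fun y => density β s t x y * density β t v y z :=
    Filter.Eventually.of_forall fun y =>
      mul_nonneg (density_nonneg hβ1 hst x y) (density_nonneg hβ1 htv y z)
  have h := lintegral_density_mul_density hβ hβ1 hst htv x z
  simp_rw [← ENNReal.ofReal_mul (density_nonneg hβ1 hst x _)] at h
  refine ⟨⟨(m1.mul m2).aestronglyMeasurable, ?_⟩, ?_⟩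
  · rw [hasFiniteIntegral_iff_ofReal h0, h]
    exact ENNReal.ofReal_lt_top
  · rw [integral_eq_lintegral_of_nonneg_ae h0 (m1.mul m2).aestronglyMeasurable, h,
      ENNReal.toReal_ofReal (density_nonneg hβ1 (hst.trans htv) x z)]

end

end SkewBM

theorem mainTheorem6 (β : ℝ≥0 → ℝ) (hβ : Measurable β) (hβ1 : ∀ r : ℝ≥0, β r ∈ Set.Icc (-1 : ℝ) 1) :
    -- the integral defining the density converges, and the density is nonnegative and Borel
    (∀ s t : ℝ≥0, s < t → ∀ x y : ℝ,
      IntervalIntegrable (SkewBM.crossingIntegrand β s t x y) volume 0 ((t : ℝ) - s) ∧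
        0 ≤ SkewBM.density β s t x y) ∧
    (∀ s t : ℝ≥0, s < t → Measurable (fun q : ℝ × ℝ => SkewBM.density β s t q.1 q.2)) ∧
    -- the measures with these densities form a family of transition probabilities
    SkewBM.IsTransitionFunction (SkewBM.transitionMeasure β) ∧
    -- the Chapman–Kolmogorov equation holds for the densities, at every pair of points
    (∀ s t v : ℝ≥0, s < t → t < v → ∀ x z : ℝ,
      Integrable (fun y => SkewBM.density β s t x y * SkewBM.density β t v y z) ∧
        ∫ y, SkewBM.density β s t x y * SkewBM.density β t v y z = SkewBM.density β s v x z) := by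
  refine ⟨fun s t hst x y => ⟨?_, SkewBM.density_nonneg hβ1 hst x y⟩,
    fun s t hst => SkewBM.measurable_density hβ hst,
    SkewBM.isTransitionFunction_transitionMeasure hβ hβ1,
    fun s t v hst htv x z => SkewBM.integral_density_mul_density hβ hβ1 hst htv x z⟩
  have hT : (0 : ℝ) < (t : ℝ) - s := sub_pos.2 (by exact_mod_cast hst)
  exact (intervalIntegrable_iff_integrableOn_Ioo_of_le hT.le).2
    (SkewBM.integrableOn_crossingIntegrand hβ hβ1 hst x y)
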